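/- **Definitions.** For a complex Hilbert space $\mathcal H$, let $\mathcal D(\mathcal H)$ be the set of density operators (positive operators of trace one). A measurement $M$ on $\mathcal H$ is a POVM on a measurable space, and $P_M(\rho)$ denotes the outcome distribution $F\mapsto \mathrm{tr}(M(F)\rho)$. For a set $\mathcal M$ of measurements put $$d_{\mathcal M}(\rho,\sigma)=\tfrac12\sup_{M\in\mathcal M}\|P_M(\rho)-P_M(\sigma)\|_1,\qquad \delta(\rho,\sigma)=\tfrac12\|\rho-\sigma\|_1,$$ where the first norm is the total variation norm and the second is the trace norm; distances to a set $\Sigma$ of states are infima over $\Sigma$. The probability representation $\mathbf P_{\mathcal M}:\rho\mapsto(P_M(\rho))_{M\in\mathcal M}$ is called *robust* if for every set $\Sigma\subseteq\mathcal D(\mathcal H)$ and every sequence $(\rho^{(n)})$ in $\mathcal D(\mathcal H)$, $d_{\mathcal M}(\rho^{(n)},\Sigma)\to0$ implies $\delta(\rho^{(n)},\Sigma)\to0$. On a bipartite system $\mathcal H_A\otimes\mathcal H_B$ (Hilbert space tensor product), $\mathcal M_\otimes$ is the set of all local measurements $M_A\otimes M_B$, i.e. POVMs on a product of two outcome spaces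 with $M(S\times T)=M_A(S)\otimes M_B(T)$ for POVMs $M_A$, $M_B$ on $\mathcal H_A$, $\mathcal H_B$. **Corollary.** 1. If $\mathcal H_A$ and $\mathcal H_B$ are infinite-dimensional separable Hilbert spaces, then the representation $\mathbf P_{\mathcal M_\otimes}$ of the states on $\mathcal H_A\otimes\mathcal H_B$ is not robust. 2. Let $R$ and $E$ be Hilbert spaces (of finite or infinite dimension), let $L\subseteq\mathbb N$, and for each $\ell\in L$ let the bit strings of length $\ell$ be encoded as orthonormal vectors $|x\rangle_\ell$, $x\in\{0,1\}^\ell$, in $R$. Let $\bar\Pi^{(\ell)}=2^{-\ell}\sum_{x}|x\rangle_\ell\langle x|_\ell$ and $\Sigma^{\mathrm{rand}}=\{\bar\Pi^{(\ell)}\otimes\sigma : \ell\in L,\ \sigma\in\mathcal D(E)\}$. Let $n\in L$, $n\ge1$, let $e_1,\dots,e_{2^n}$ be any orthonormal basis of the span of the vectors $|x\rangle_n$ in $R$, and let $f_1,\dots,f_{2^n}$ be any orthonormal vectors in $E$. Then $$\rho^{(n)}=\frac{1}{\binom{2^n}{2}}\sum_{1\le u<v\le 2^n}\pi_{u,v},$$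 where $\pi_{u,v}$ is the orthogonal projector onto the line spanned by $e_u\otimes f_v-e_v\otimes f_u$, is a density operator on $R\otimes E$, and $$\delta(\rho^{(n)},\Sigma^{\mathrm{rand}})\ \ge\ \tfrac14,\qquad d_{\mathcal M_\otimes}(\rho^{(n)},\Sigma^{\mathrm{rand}})\ \le\ 2^{-n}.$$ -/

import Mathlib

open Filter Topology MeasureTheory
open scoped TensorProduct ENNReal InnerProductSpace

universe u v

noncomputable section

namespace ProbRep

section SingleSystem

variable (H : Type u) [NormedAddCommGroup H] [InnerProductSpace ℂ H] [CompleteSpace H]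

/-- An index set for an orthonormal basis of the Hilbert space `H`. -/
def basisIndex : Set H := (exists_hilbertBasis ℂ H).choose

/-- A fixed orthonormal basis of `H`, used to write down traces. The value of the trace does not
depend on the basis for positive operators and for trace-class operators. -/
def basis : HilbertBasis (basisIndex H) ℂ H := (exists_hilbertBasis ℂ H).choose_spec.choose

variable {H}

/-- The trace of a (trace-class) operator. -/
def opTrace (T : H →L[ℂ] H) : ℂ := ∑' i, ⟪basis H i, T (basis H i)⟫_ℂ

/-- The trace norm `‖T‖₁ = tr |T|`, where `|T| = √(T* T)`; it is `∞` if `T` is not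
trace-class. -/
def traceNorm (T : H →L[ℂ] H) : ℝ≥0∞ :=
  ∑' i, ENNReal.ofReal (⟪basis H i, CFC.abs T (basis H i)⟫_ℂ).re

variable (H)

/-- Density operators: positive operators of trace one. (If the diagonal of a positive operator is
not summable then `opTrace` is `0`, so the second condition includes summability.) -/
structure DensityOperator where
  op : H →L[ℂ] H
  pos : op.IsPositive
  trace_eq_one : opTrace op = 1

/-- Positive operator valued measures on the measurable space `Ω`: the effects are positive, they
are (weakly) countably additive, and the effect of the whole space is the identity. Only the values
on measurable sets matter. -/
structure POVM (Ω : Type) [MeasurableSpace Ω] where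
  effect : Set Ω → (H →L[ℂ] H)
  pos : ∀ F, MeasurableSet F → (effect F).IsPositive
  effect_univ : effect Set.univ = 1
  hasSum_iUnion : ∀ F : ℕ → Set Ω, (∀ i, MeasurableSet (F i)) →
    Pairwise (Function.onFun Disjoint F) →
    ∀ ψ : H, HasSum (fun i => ⟪ψ, effect (F i) ψ⟫_ℂ) ⟪ψ, effect (⋃ i, F i) ψ⟫_ℂ

/-- A measurement on `H`: an outcome space together with a POVM on it. -/
structure Measurement where
  Outcome : Type
  [measurableSpace : MeasurableSpace Outcome]
  povm : POVM H Outcome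

attribute [instance] Measurement.measurableSpace

variable {H}

/-- The outcome distribution `P_M(ρ) : F ↦ tr (M(F) ρ)`, as a function on (measurable) sets. -/
def outcomeProb (M : Measurement H) (ρ : DensityOperator H) (F : Set M.Outcome) : ℝ :=
  (opTrace (M.povm.effect F ∘L ρ.op)).re

/-- The total variation norm `‖ν‖₁` of a set function `ν`: the supremum of `∑ |ν S|` over all
finite families of pairwise disjoint measurable sets `S`. -/
def l1Norm {Ω : Type} [MeasurableSpace Ω] (ν : Set Ω → ℝ) : ℝ≥0∞ :=
  ⨆ (𝓕 : Finset (Set Ω)) (_ : ∀ S ∈ 𝓕, MeasurableSet S)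
    (_ : (𝓕 : Set (Set Ω)).PairwiseDisjoint id), ∑ S ∈ 𝓕, ENNReal.ofReal |ν S|

/-- The distance `d_𝓜(ρ, σ) = ½ sup_{M ∈ 𝓜} ‖P_M(ρ) - P_M(σ)‖₁`. -/
def measDist (𝓜 : Set (Measurement H)) (ρ σ : DensityOperator H) : ℝ≥0∞ :=
  2⁻¹ * ⨆ M ∈ 𝓜, l1Norm fun F => outcomeProb M ρ F - outcomeProb M σ F

/-- The trace distance `δ(ρ, σ) = ½ ‖ρ - σ‖₁`. -/
def traceDist (ρ σ : DensityOperator H) : ℝ≥0∞ := 2⁻¹ * traceNorm (ρ.op - σ.op)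

/-- The distance `d(ρ, S) = inf_{σ ∈ S} d(ρ, σ)` of a state to a set of states. -/
def distToSet (d : DensityOperator H → DensityOperator H → ℝ≥0∞) (ρ : DensityOperator H)
    (S : Set (DensityOperator H)) : ℝ≥0∞ :=
  ⨅ σ ∈ S, d ρ σ

/-- The probability representation given by the set `𝓜` of measurements is (topologically) robust:
for all sets `S` and all sequences `ρ` of states, convergence of `ρ` to `S` in `d_𝓜` implies
convergence in trace distance. -/
def IsRobust (𝓜 : Set (Measurement H)) : Prop :=
  ∀ (S : Set (DensityOperator H)) (ρ : ℕ → DensityOperator H),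
    Tendsto (fun n => distToSet (measDist 𝓜) (ρ n) S) atTop (𝓝 0) →
    Tendsto (fun n => distToSet traceDist (ρ n) S) atTop (𝓝 0)

/-- The operator `2^{-ℓ} ∑ₓ |enc x⟩⟨enc x|`, where `x` ranges over the bit strings of length `ℓ`:
the uniform state on these bit strings if `enc` is orthonormal. -/
def uniformOp {ℓ : ℕ} (enc : (Fin ℓ → Bool) → H) : H →L[ℂ] H :=
  ((2 : ℂ) ^ ℓ)⁻¹ • ∑ x : Fin ℓ → Bool, (ℂ ∙ enc x).starProjection

end SingleSystem

section Bipartite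

variable (HA : Type u) [NormedAddCommGroup HA] [InnerProductSpace ℂ HA] [CompleteSpace HA]
variable (HB : Type v) [NormedAddCommGroup HB] [InnerProductSpace ℂ HB] [CompleteSpace HB]

/-- The Hilbert space tensor product: the completion of the algebraic tensor product with respect
to the inner product `⟪a ⊗ b, a' ⊗ b'⟫ = ⟪a, a'⟫ ⟪b, b'⟫`. -/
abbrev HilbertTensor : Type (max u v) := UniformSpace.Completion (HA ⊗[ℂ] HB)

variable {HA HB}

/-- The vector `a ⊗ b`. -/
def tensorVec (a : HA) (b : HB) : HilbertTensor HA HB := ((a ⊗ₜ[ℂ] b : HA ⊗[ℂ] HB) : _)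

/-- The bounded operator `A ⊗ B`. -/
def tensorOp (A : HA →L[ℂ] HA) (B : HB →L[ℂ] HB) :
    HilbertTensor HA HB →L[ℂ] HilbertTensor HA HB :=
  (TensorProduct.mapL A B).completion

variable (HA HB)

/-- The set `𝓜_⊗` of local measurements `M_A ⊗ M_B`: POVMs on a product of two outcome spaces with
`M(S × T) = M_A(S) ⊗ M_B(T)` for all measurable `S` and `T`. -/
def localMeasurements : Set (Measurement (HilbertTensor HA HB)) :=
  {M | ∃ (ΩA ΩB : Type) (_ : MeasurableSpace ΩA) (_ : MeasurableSpace ΩB)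
      (MA : POVM HA ΩA) (MB : POVM HB ΩB) (N : POVM (HilbertTensor HA HB) (ΩA × ΩB)),
      (∀ S T, MeasurableSet S → MeasurableSet T →
        N.effect (S ×ˢ T) = tensorOp (MA.effect S) (MB.effect T)) ∧
      M = { Outcome := ΩA × ΩB, povm := N }}

variable {HA}

/-- The set of perfectly random states `Π̄^(ℓ) ⊗ σ`: the first system holds a uniformly distributed
bit string, whose length `ℓ` is among the admissible lengths `L`, and is independent of the second
system, which is in an arbitrary state `σ`. The bit strings of length `ℓ` are encoded in the first
system by the vectors `enc ℓ x`. -/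
def randomStates (L : Set ℕ) (enc : (ℓ : ℕ) → (Fin ℓ → Bool) → HA) :
    Set (DensityOperator (HilbertTensor HA HB)) :=
  {τ | ∃ ℓ ∈ L, ∃ σ : DensityOperator HB, τ.op = tensorOp (uniformOp (enc ℓ)) σ.op}

variable {HB}

/-- The operator `(N(N-1)/2)⁻¹ ∑_{i < j} π_{i,j}`, where `π_{i,j}` is the orthogonal projection
onto the line spanned by `e_i ⊗ f_j - e_j ⊗ f_i`: the normalised projection onto the antisymmetric
subspace, if `e` and `f` are orthonormal. -/
def antisymOp {N : ℕ} (e : Fin N → HA) (f : Fin N → HB) :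
    HilbertTensor HA HB →L[ℂ] HilbertTensor HA HB :=
  ((N * (N - 1) / 2 : ℂ))⁻¹ • ∑ p : Fin N × Fin N with p.1 < p.2,
    (ℂ ∙ (tensorVec (e p.1) (f p.2) - tensorVec (e p.2) (f p.1))).starProjection

end Bipartite

end ProbRep

end

/-!
Let `N = 2 ^ n`, let `P` be the projection onto the span of the vectors `eᵤ ⊗ fᵥ`, and let
`W : eᵤ ⊗ fᵥ ↦ eᵥ ⊗ fᵤ` be the swap on this span. Then `ρ = (P - W) / (N (N - 1))` is the normalised
projection onto the antisymmetric subspace. Everything rests on the positivity of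
`tr ((A ⊗ B) W) = ∑ᵤᵥ Aᵤᵥ Bᵥᵤ` for positive `A` and `B` (`sum_inner_mul_inner_nonneg`, from the
Schur product theorem).

*Trace distance.* By this positivity a product state has overlap at most `1 / 2` with the
antisymmetric subspace (`sum_re_inner_tensorOp_altVec_le`), whereas `ρ` has overlap `1`. As
`T ≤ |T|`, the trace norm of `T = ρ - τ` dominates the difference `1 / 2` of the overlaps
(`ofReal_sum_re_inner_le_traceNorm`), so that `δ(ρ, τ) ≥ 1 / 4` for every product state `τ`.

*Local measurements.* The state `τ = P / N²` is perfectly random. For a local measurement `M` the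
set function `F ↦ tr (M(F) W)` is nonnegative on measurable rectangles, hence on all measurable sets
(`measure_le_of_rectangles`, `sumMeasure_altVec_le_sumMeasure_symVec`), and its total mass is
`tr W = N`. Since `tr (M(F) (P - W)) ≥ 0`, this gives
`P_M(τ)(F) - P_M(ρ)(F) ≤ N⁻² tr (M(F) W)`. Both distributions have mass one, so half of their total
variation distance is at most `N⁻² · N = N⁻¹` (`l1Norm_le_of_signedMeasure`).

In infinite dimension the construction is available for all `n` at once, which refutes robustness.
-/

namespace ProbRep
open InnerProductSpace
open scoped ComplexOrder

/-! ### Finite measures on product spaces -/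

theorem isSetSemiring_measurableRectangles (α β : Type*) [MeasurableSpace α] [MeasurableSpace β] :
    IsSetSemiring
      (Set.image2 (· ×ˢ ·) {s : Set α | MeasurableSet s} {t : Set β | MeasurableSet t}) where
  empty_mem := ⟨∅, .empty, ∅, .empty, by simp⟩
  inter_mem := by
    rintro _ ⟨s, hs, t, ht, rfl⟩ _ ⟨s', hs', t', ht', rfl⟩
    exact ⟨s ∩ s', hs.inter hs', t ∩ t', ht.inter ht', Set.prod_inter_prod.symm⟩
  sdiff_eq_sUnion' := by
    classical
    rintro _ ⟨s, hs, t, ht, rfl⟩ _ ⟨s', hs', t', ht', rfl⟩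
    refine ⟨{(s \ s') ×ˢ t, (s ∩ s') ×ˢ (t \ t')}, ?_, ?_, ?_⟩
    · intro x hx
      simp only [Finset.coe_insert, Finset.coe_singleton, Set.mem_insert_iff,
        Set.mem_singleton_iff] at hx
      rcases hx with rfl | rfl
      · exact ⟨_, hs.diff hs', _, ht, rfl⟩
      · exact ⟨_, hs.inter hs', _, ht.diff ht', rfl⟩
    · rw [Finset.coe_insert, Finset.coe_singleton]
      refine Set.pairwiseDisjoint_insert.2 ⟨Set.pairwiseDisjoint_singleton _ _, ?_⟩
      rintro _ rfl _
      exact Set.disjoint_prod.2 (Or.inl (Set.disjoint_sdiff_left.mono_right Set.inter_subset_right))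
    · ext ⟨x, y⟩
      simp
      tauto

/-- A finite measure is the infimum of its values on countable covers by sets of a generating
semiring, so comparing measures on the semiring is enough. -/
theorem measure_le_of_isSetSemiring {α : Type*} [mα : MeasurableSpace α] {C : Set (Set α)}
    (hC : IsSetSemiring C) (hgen : mα = MeasurableSpace.generateFrom C) (huniv : Set.univ ∈ C)
    {μ ν : Measure α} [IsFiniteMeasure ν] (h : ∀ s ∈ C, μ s ≤ ν s) : μ ≤ ν := by
  have hmeas : ∀ s ∈ C, MeasurableSet s := fun s hs => by
    rw [hgen]; exact MeasurableSpace.measurableSet_generateFrom hs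
  let m : AddContent ℝ≥0∞ C :=
    { toFun := ν
      empty' := measure_empty
      sUnion' := fun I hI hd _ => by
        rw [Set.sUnion_eq_biUnion]
        exact measure_biUnion_finset hd fun s hs => hmeas s (hI hs) }
  have hm : m.IsSigmaSubadditive := fun f _ _ => measure_iUnion_le (μ := ν) f
  have hν : ν = m.measure hC hgen.le hm :=
    ext_of_generate_finite C hgen hC.isPiSystem
      (fun s hs => (m.measure_eq hC hgen hm hs).symm)
      (m.measure_eq hC hgen hm huniv).symm
  refine Measure.le_iff.2 fun s hs => ?_
  have hle : μ.toOuterMeasure ≤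
      inducedOuterMeasure (fun t _ => m t) hC.empty_mem addContent_empty :=
    le_inducedOuterMeasure.2 fun t ht => h t ht
  rw [hν]
  refine (hle s).trans ?_
  exact le_trim (μ := m.measureCaratheodory hC hm)
    (fun t ht => AddContent.isCaratheodory_inducedOuterMeasure hC m t (hgen.le t ht))

theorem measure_le_of_rectangles {α β : Type*} [MeasurableSpace α] [MeasurableSpace β]
    {μ ν : Measure (α × β)} [IsFiniteMeasure ν]
    (h : ∀ s t, MeasurableSet s → MeasurableSet t → μ (s ×ˢ t) ≤ ν (s ×ˢ t)) : μ ≤ ν :=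
  measure_le_of_isSetSemiring (isSetSemiring_measurableRectangles α β) generateFrom_prod.symm
    ⟨Set.univ, .univ, Set.univ, .univ, Set.univ_prod_univ⟩
    (by rintro _ ⟨s, hs, t, ht, rfl⟩; exact h s t hs ht)

/-! ### The total variation norm -/

/-- If `D` has total mass zero and its negative part is dominated by `h`, then its total variation
is at most twice the mass of `h`. -/
theorem l1Norm_le_of_signedMeasure {Ω : Type} [MeasurableSpace Ω] {ν : Set Ω → ℝ}
    {D h : SignedMeasure Ω} (hν : ∀ S, MeasurableSet S → ν S = D S) (huniv : D Set.univ = 0)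
    (hpos : ∀ S, MeasurableSet S → 0 ≤ h S) (hle : ∀ S, MeasurableSet S → -D S ≤ h S) :
    l1Norm ν ≤ ENNReal.ofReal (2 * h Set.univ) := by
  refine iSup_le fun F => iSup_le fun hF => iSup_le fun hd => ?_
  rw [← ENNReal.ofReal_sum_of_nonneg fun _ _ => abs_nonneg _]
  -- `|D S| ≤ D S + 2 h S`; sum this, and use `D U = -D Uᶜ ≤ h Uᶜ` for the union `U`.
  refine ENNReal.ofReal_le_ofReal ?_
  set U : Set Ω := ⋃ S ∈ F, S
  have hUm : MeasurableSet U := F.measurableSet_biUnion hF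
  have add : ∀ m : SignedMeasure Ω, ∑ S ∈ F, m S = m U := fun m =>
    (m.of_biUnion_finset hd hF).symm
  have compl : ∀ m : SignedMeasure Ω, m U + m Uᶜ = m Set.univ := fun m => by
    rw [Set.compl_eq_univ_sdiff]
    exact m.of_add_of_sdiff hUm .univ (Set.subset_univ U)
  calc ∑ S ∈ F, |ν S| ≤ ∑ S ∈ F, (D S + 2 * h S) := Finset.sum_le_sum fun S hS => by
        rw [hν S (hF S hS), abs_le]
        constructor <;> linarith [hpos S (hF S hS), hle S (hF S hS)]
    _ = D U + 2 * h U := by rw [Finset.sum_add_distrib, ← Finset.mul_sum, add, add]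
    _ ≤ 2 * h Set.univ := by
        linarith [compl D, compl h, hle _ hUm.compl, hpos _ hUm.compl]

/-! ### Outcome distributions -/

section POVM

variable {H : Type*} [NormedAddCommGroup H] [InnerProductSpace ℂ H]
  {Ω : Type} [MeasurableSpace Ω]

theorem POVM.effect_empty (M : POVM H Ω) (ψ : H) : ⟪ψ, M.effect ∅ ψ⟫_ℂ = 0 := by
  have h := M.hasSum_iUnion (fun _ => ∅) (fun _ => .empty) (fun _ _ _ => disjoint_bot_left) ψ
  exact (summable_const_iff _).1 h.summable

/-- The measure `F ↦ ⟨ψ, M(F) ψ⟩`. -/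
noncomputable def POVM.measure (M : POVM H Ω) (ψ : H) : Measure Ω :=
  Measure.ofMeasurable (fun F _ => ENNReal.ofReal (⟪ψ, M.effect F ψ⟫_ℂ).re)
    (by simp [M.effect_empty]) fun F hF hd => by
      have h := Complex.hasSum_re (M.hasSum_iUnion F hF hd ψ)
      rw [← h.tsum_eq]
      exact ENNReal.ofReal_tsum_of_nonneg
        (fun i => (M.pos _ (hF i)).re_inner_nonneg_right ψ) h.summable

theorem POVM.measure_apply (M : POVM H Ω) (ψ : H) {F : Set Ω} (hF : MeasurableSet F) :
    M.measure ψ F = ENNReal.ofReal (⟪ψ, M.effect F ψ⟫_ℂ).re :=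
  Measure.ofMeasurable_apply F hF

instance (M : POVM H Ω) (ψ : H) : IsFiniteMeasure (M.measure ψ) :=
  ⟨by rw [M.measure_apply ψ .univ]; exact ENNReal.ofReal_lt_top⟩

/-- The measure `F ↦ ∑ᵢ ⟨wᵢ, M(F) wᵢ⟩ = tr (M(F) ∑ᵢ |wᵢ⟩⟨wᵢ|)`. -/
noncomputable def POVM.sumMeasure (M : POVM H Ω) {ι : Type*} [Fintype ι] (w : ι → H) : Measure Ω :=
  ∑ i, M.measure (w i)

instance (M : POVM H Ω) {ι : Type*} [Fintype ι] (w : ι → H) : IsFiniteMeasure (M.sumMeasure w) := by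
  unfold POVM.sumMeasure; infer_instance

theorem POVM.sumMeasure_apply (M : POVM H Ω) {ι : Type*} [Fintype ι] (w : ι → H) {F : Set Ω}
    (hF : MeasurableSet F) :
    M.sumMeasure w F = ENNReal.ofReal (∑ i, (⟪w i, M.effect F (w i)⟫_ℂ).re) := by
  rw [ENNReal.ofReal_sum_of_nonneg fun i _ => by
    exact (M.pos _ hF).re_inner_nonneg_right (w i)]
  simp [sumMeasure, M.measure_apply _ hF]

theorem POVM.sumMeasure_toSignedMeasure_apply (M : POVM H Ω) {ι : Type*} [Fintype ι] (w : ι → H)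
    {F : Set Ω} (hF : MeasurableSet F) :
    (M.sumMeasure w).toSignedMeasure F = ∑ i, (⟪w i, M.effect F (w i)⟫_ℂ).re := by
  rw [Measure.toSignedMeasure_apply_measurable hF, Measure.real, M.sumMeasure_apply w hF,
    ENNReal.toReal_ofReal]
  exact Finset.sum_nonneg fun i _ => (M.pos _ hF).re_inner_nonneg_right (w i)

end POVM

/-! ### Traces -/

section Trace

variable {H : Type*} [NormedAddCommGroup H] [InnerProductSpace ℂ H]

theorem starProjection_span_singleton_eq_smul_rankOne (w : H) :
    (ℂ ∙ w).starProjection = ((‖w‖ : ℂ) ^ 2)⁻¹ • rankOne ℂ w w := by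
  ext x
  rw [Submodule.starProjection_singleton]
  simp [div_eq_inv_mul, mul_smul]

theorem isPositive_smul_sum_rankOne {ι : Type*} [Fintype ι] {c : ℝ} (hc : 0 ≤ c) (w : ι → H) :
    ((c : ℂ) • ∑ i, rankOne ℂ (w i) (w i)).IsPositive :=
  (ContinuousLinearMap.isPositive_sum _ fun i _ => isPositive_rankOne_self (w i)).smul_of_nonneg
    (by exact_mod_cast hc)

theorem _root_.Orthonormal.sum_enorm_inner_sq_le {ι : Type*} [Fintype ι] {w : ι → H}
    (hw : Orthonormal ℂ w) (x : H) : ∑ i, ‖⟪w i, x⟫_ℂ‖ₑ ^ 2 ≤ ‖x‖ₑ ^ 2 := by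
  have := ENNReal.ofReal_le_ofReal (hw.sum_inner_products_le x (s := Finset.univ))
  rw [ENNReal.ofReal_sum_of_nonneg fun _ _ => by positivity] at this
  simpa [ENNReal.ofReal_pow, ofReal_norm] using this

/-- The compression of a positive operator to a finite family of vectors is a positive matrix. -/
theorem posSemidef_inner_apply {ι : Type*} [Fintype ι] {A : H →L[ℂ] H} (hA : A.IsPositive)
    (e : ι → H) : (Matrix.of fun u v => ⟪e u, A (e v)⟫_ℂ).PosSemidef := by
  refine Matrix.posSemidef_iff_dotProduct_mulVec.2 ⟨?_, fun x => ?_⟩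
  · ext u v
    simp [Matrix.conjTranspose_apply, hA.inner_left_eq_inner_right]
  · have h := hA.inner_nonneg_right (∑ u, x u • e u)
    convert h using 1
    simp only [dotProduct, Matrix.mulVec, Matrix.of_apply, Pi.star_apply, RCLike.star_def,
      sum_inner, inner_sum, map_sum, map_smul, inner_smul_left, inner_smul_right, Finset.mul_sum]
    rw [Finset.sum_comm]
    exact Finset.sum_congr rfl fun u _ => Finset.sum_congr rfl fun v _ => by ring

/-- The trace `∑ᵤᵥ Aᵤᵥ Bᵥᵤ` of the product of the matrices of two positive operators is
nonnegative: it is the sum of the entries of a Hadamard product of positive matrices. -/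
theorem sum_inner_mul_inner_nonneg {K : Type*} [NormedAddCommGroup K] [InnerProductSpace ℂ K]
    {ι : Type*} [Fintype ι] {A : H →L[ℂ] H} {B : K →L[ℂ] K}
    (hA : A.IsPositive) (hB : B.IsPositive) (e : ι → H) (f : ι → K) :
    0 ≤ ∑ u, ∑ v, (⟪e u, A (e v)⟫_ℂ * ⟪f v, B (f u)⟫_ℂ).re := by
  have h := (((posSemidef_inner_apply hA e).hadamard
    (posSemidef_inner_apply hB f).transpose).dotProduct_mulVec_nonneg 1)
  have h' := (Complex.le_def.1 h).1
  simpa [dotProduct, Matrix.mulVec] using h'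

variable [CompleteSpace H]

theorem opTrace_comp_smul_sum_rankOne {ι : Type*} [Fintype ι] (T : H →L[ℂ] H) (c : ℂ) (w : ι → H) :
    opTrace (T ∘L (c • ∑ i, rankOne ℂ (w i) (w i))) = c * ∑ i, ⟪w i, T (w i)⟫_ℂ := by
  have h : HasSum (fun j => ∑ i, ⟪w i, basis H j⟫_ℂ * ⟪basis H j, T (w i)⟫_ℂ)
      (∑ i, ⟪w i, T (w i)⟫_ℂ) :=
    hasSum_sum fun i _ => (basis H).hasSum_inner_mul_inner (w i) (T (w i))
  rw [← (h.mul_left c).tsum_eq, opTrace]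
  refine tsum_congr fun j => ?_
  simp only [ContinuousLinearMap.comp_apply, smul_apply, sum_apply, rankOne_apply, map_smul,
    map_sum, inner_smul_right, inner_sum]

theorem opTrace_smul_sum_rankOne {ι : Type*} [Fintype ι] (c : ℂ) (w : ι → H) :
    opTrace (c • ∑ i, rankOne ℂ (w i) (w i)) = c * ∑ i, ⟪w i, w i⟫_ℂ :=
  opTrace_comp_smul_sum_rankOne (.id ℂ H) c w

/-- The junk value `0` of a divergent sum is excluded by `opTrace A = 1`, so the diagonal of `A` is
summable. -/
theorem tsum_ofReal_re_inner_eq_one {A : H →L[ℂ] H} (hA : A.IsPositive) (h : opTrace A = 1) :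
    ∑' i, ENNReal.ofReal (⟪basis H i, A (basis H i)⟫_ℂ).re = 1 := by
  have hs : Summable fun i => ⟪basis H i, A (basis H i)⟫_ℂ := by
    by_contra hs
    rw [opTrace, tsum_eq_zero_of_not_summable hs] at h
    exact zero_ne_one h
  have hr : HasSum (fun i => (⟪basis H i, A (basis H i)⟫_ℂ).re) (opTrace A).re :=
    Complex.hasSum_re hs.hasSum
  have hn := ENNReal.ofReal_tsum_of_nonneg (f := fun i => (⟪basis H i, A (basis H i)⟫_ℂ).re)
    (fun i => hA.re_inner_nonneg_right (basis H i)) hr.summable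
  rw [hr.tsum_eq, h, Complex.one_re, ENNReal.ofReal_one] at hn
  exact hn.symm

theorem tsum_enorm_inner_sq (x : H) :
    ∑' j, ‖⟪basis H j, x⟫_ℂ‖ₑ ^ 2 = ‖x‖ₑ ^ 2 := by
  have h := (basis H).hasSum_inner_mul_inner x x
  have h' := Complex.hasSum_re h
  have e : ∀ j, (⟪x, basis H j⟫_ℂ * ⟪basis H j, x⟫_ℂ).re = ‖⟪basis H j, x⟫_ℂ‖ ^ 2 := fun j => by
    rw [← inner_conj_symm, mul_comm, Complex.mul_conj, Complex.normSq_eq_norm_sq]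
    norm_cast
  simp only [e] at h'
  have e2 : (⟪x, x⟫_ℂ).re = ‖x‖ ^ 2 := by rw [inner_self_eq_norm_sq_to_K]; norm_cast
  rw [e2] at h'
  have := ENNReal.ofReal_tsum_of_nonneg (fun j => by positivity) h'.summable
  rw [h'.tsum_eq] at this
  simpa [ENNReal.ofReal_pow, ofReal_norm] using this.symm

/-- A positive operator `A` has `∑ᵢ ⟨wᵢ, A wᵢ⟩ ≤ C tr A` for all families `w` with Bessel
bound `C`. -/
theorem sum_ofReal_re_inner_le {ι : Type*} [Fintype ι] {w : ι → H} {C : ℝ≥0∞}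
    (hw : ∀ x, ∑ i, ‖⟪w i, x⟫_ℂ‖ₑ ^ 2 ≤ C * ‖x‖ₑ ^ 2) {A : H →L[ℂ] H} (hA : 0 ≤ A) :
    ∑ i, ENNReal.ofReal (⟪w i, A (w i)⟫_ℂ).re ≤
      C * ∑' j, ENNReal.ofReal (⟪basis H j, A (basis H j)⟫_ℂ).re := by
  -- With `B = √A` both sides are sums of `‖B w‖²`, compared by Parseval and Tonelli.
  set B := CFC.sqrt A with hB
  have hBs : IsSelfAdjoint B := IsSelfAdjoint.of_nonneg (CFC.sqrt_nonneg A)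
  have sym : ∀ x y, ⟪B x, y⟫_ℂ = ⟪x, B y⟫_ℂ := fun x y => hBs.isSymmetric x y
  have key : ∀ x, ENNReal.ofReal (⟪x, A x⟫_ℂ).re = ‖B x‖ₑ ^ 2 := fun x => by
    have : A x = B (B x) := by
      rw [← mul_apply_eq_comp, hB, CFC.sqrt_mul_sqrt_self A hA]
    have hn : (⟪B x, B x⟫_ℂ).re = ‖B x‖ ^ 2 := inner_self_eq_norm_sq (𝕜 := ℂ) (B x)
    rw [this, ← sym, hn, ENNReal.ofReal_pow (norm_nonneg _), ofReal_norm]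
  simp only [key]
  calc ∑ i, ‖B (w i)‖ₑ ^ 2 = ∑ i, ∑' j, ‖⟪basis H j, B (w i)⟫_ℂ‖ₑ ^ 2 := by
        simp only [tsum_enorm_inner_sq]
    _ = ∑' j, ∑ i, ‖⟪basis H j, B (w i)⟫_ℂ‖ₑ ^ 2 :=
        (Summable.tsum_finsetSum fun _ _ => ENNReal.summable).symm
    _ ≤ ∑' j, C * ‖B (basis H j)‖ₑ ^ 2 := ENNReal.tsum_le_tsum fun j => by
        refine le_of_eq_of_le (Finset.sum_congr rfl fun i _ => ?_) (hw (B (basis H j)))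
        rw [← sym, ← inner_conj_symm, RCLike.enorm_conj]
    _ = _ := ENNReal.tsum_mul_left

theorem sum_re_inner_le_one {ι : Type*} [Fintype ι] {w : ι → H} (hw : Orthonormal ℂ w)
    {A : H →L[ℂ] H} (hA : A.IsPositive) (h : opTrace A = 1) :
    ∑ i, (⟪w i, A (w i)⟫_ℂ).re ≤ 1 := by
  have := sum_ofReal_re_inner_le (C := 1) (fun x => by simpa using hw.sum_enorm_inner_sq_le x)
    ((ContinuousLinearMap.nonneg_iff_isPositive A).2 hA)
  rw [tsum_ofReal_re_inner_eq_one hA h, ← ENNReal.ofReal_sum_of_nonneg fun i _ => by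
    exact hA.re_inner_nonneg_right (w i), one_mul, ENNReal.ofReal_le_one] at this
  exact this

/-- The trace norm dominates `∑ᵢ ⟨wᵢ, T wᵢ⟩`, up to the Bessel bound of `w`, because
`T ≤ |T|`. -/
theorem ofReal_sum_re_inner_le_traceNorm {ι : Type*} [Fintype ι] {w : ι → H} {C : ℝ≥0∞}
    (hw : ∀ x, ∑ i, ‖⟪w i, x⟫_ℂ‖ₑ ^ 2 ≤ C * ‖x‖ₑ ^ 2) {T : H →L[ℂ] H} (hT : IsSelfAdjoint T) :
    ENNReal.ofReal (∑ i, (⟪w i, T (w i)⟫_ℂ).re) ≤ C * traceNorm T := by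
  refine le_trans ?_ (sum_ofReal_re_inner_le hw (CFC.abs_nonneg T))
  have h0 : 0 ≤ CFC.abs T - T := by
    rw [CFC.abs_sub_self T]
    exact nsmul_nonneg (CFC.negPart_nonneg T) 2
  have h1 := (ContinuousLinearMap.nonneg_iff_isPositive _).1 h0
  have h2 := (ContinuousLinearMap.nonneg_iff_isPositive _).1 (CFC.abs_nonneg T)
  rw [← ENNReal.ofReal_sum_of_nonneg fun i _ => by exact h2.re_inner_nonneg_right (w i)]
  refine ENNReal.ofReal_le_ofReal (Finset.sum_le_sum fun i _ => ?_)
  have := h1.re_inner_nonneg_right (w i)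
  simpa [inner_sub_right] using this

end Trace

/-! ### Antisymmetrised orthonormal families -/

section Antisym

variable {K : Type*} [NormedAddCommGroup K] {ι : Type*}

/-- The unnormalised antisymmetrisation `E_{uv} - E_{vu}` of a doubly indexed family of vectors. -/
def altVec (E : ι × ι → K) (p : ι × ι) : K := E p - E p.swap

/-- The unnormalised symmetrisation `E_{uv} + E_{vu}` of a doubly indexed family of vectors. -/
def symVec (E : ι × ι → K) (p : ι × ι) : K := E p + E p.swap

theorem altVec_swap (E : ι × ι → K) (p : ι × ι) : altVec E p.swap = -altVec E p := by
  simp [altVec]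

variable [InnerProductSpace ℂ K] [Fintype ι]

theorem sum_swap {M : Type*} [AddCommMonoid M] (g : ι × ι → M) : ∑ p : ι × ι, g p.swap = ∑ p, g p :=
  (Equiv.prodComm ι ι).sum_comp g

theorem sum_inner_altVec (E : ι × ι → K) (M : K →L[ℂ] K) :
    ∑ p, ⟪altVec E p, M (altVec E p)⟫_ℂ =
      2 * (∑ p, ⟪E p, M (E p)⟫_ℂ - ∑ p : ι × ι, ⟪E p, M (E p.swap)⟫_ℂ) := by
  have h1 := sum_swap fun p => ⟪E p, M (E p)⟫_ℂ
  have h2 := sum_swap fun p => ⟪E p, M (E p.swap)⟫_ℂ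
  simp only [Prod.swap_swap] at h2
  simp only [altVec, map_sub, inner_sub_left, inner_sub_right, Finset.sum_sub_distrib, h1, h2]
  ring

theorem sum_inner_symVec (E : ι × ι → K) (M : K →L[ℂ] K) :
    ∑ p, ⟪symVec E p, M (symVec E p)⟫_ℂ =
      2 * (∑ p, ⟪E p, M (E p)⟫_ℂ + ∑ p : ι × ι, ⟪E p, M (E p.swap)⟫_ℂ) := by
  have h1 := sum_swap fun p => ⟪E p, M (E p)⟫_ℂ
  have h2 := sum_swap fun p => ⟪E p, M (E p.swap)⟫_ℂ
  simp only [Prod.swap_swap] at h2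
  simp only [symVec, map_add, inner_add_left, inner_add_right, Finset.sum_add_distrib, h1, h2]
  ring

theorem sum_inner_swap {E : ι × ι → K} (hE : Orthonormal ℂ E) :
    ∑ p : ι × ι, ⟪E p, E p.swap⟫_ℂ = Fintype.card ι := by
  classical
  simp only [orthonormal_iff_ite.1 hE, Fintype.sum_prod_type, Prod.swap_prod_mk, Prod.mk.injEq]
  have : ∀ x y : ι, (if x = y ∧ y = x then (1 : ℂ) else 0) = if x = y then 1 else 0 := fun x y => by
    by_cases h : x = y <;> simp [h]
  simp [this]

theorem sum_inner_altVec_self {E : ι × ι → K} (hE : Orthonormal ℂ E) :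
    ∑ p, ⟪altVec E p, altVec E p⟫_ℂ = 2 * ((Fintype.card ι : ℂ) ^ 2 - Fintype.card ι) := by
  have h := sum_inner_altVec E (.id ℂ K)
  simp only [ContinuousLinearMap.id_apply, sum_inner_swap hE] at h
  rw [h]
  simp [inner_self_eq_norm_sq_to_K, hE.1, sq]

theorem sum_inner_symVec_self {E : ι × ι → K} (hE : Orthonormal ℂ E) :
    ∑ p, ⟪symVec E p, symVec E p⟫_ℂ = 2 * ((Fintype.card ι : ℂ) ^ 2 + Fintype.card ι) := by
  have h := sum_inner_symVec E (.id ℂ K)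
  simp only [ContinuousLinearMap.id_apply, sum_inner_swap hE] at h
  rw [h]
  simp [inner_self_eq_norm_sq_to_K, hE.1, sq]

/-- `∑ₚ |dₚ⟩⟨dₚ|` is four times the projection onto the span of the antisymmetrised vectors `dₚ`:
each direction occurs twice, and `‖dₚ‖² = 2` off the diagonal. -/
theorem sum_rankOne_altVec_apply {E : ι × ι → K} (hE : Orthonormal ℂ E) (p : ι × ι) :
    (∑ q, rankOne ℂ (altVec E q) (altVec E q)) (altVec E p) = (4 : ℂ) • altVec E p := by
  classical
  have h : ∀ q, ⟪altVec E q, altVec E p⟫_ℂ =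
      (if q = p then 2 else 0) - (if q = p.swap then 2 else 0) := fun q => by
    have h1 : (q.swap = p.swap) = (q = p) := by simp
    have h2 : (q.swap = p) = (q = p.swap) := by
      rw [← Prod.swap_inj (p := q.swap), Prod.swap_swap]
    simp only [altVec, inner_sub_left, inner_sub_right, orthonormal_iff_ite.1 hE, h1, h2]
    split_ifs <;> norm_num
  simp only [sum_apply, rankOne_apply, h, sub_smul, ite_smul, zero_smul, Finset.sum_sub_distrib,
    Finset.sum_ite_eq', Finset.mem_univ, if_true, altVec_swap]
  module

theorem sum_enorm_inner_altVec_sq_le {E : ι × ι → K} (hE : Orthonormal ℂ E) (x : K) :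
    ∑ p, ‖⟪altVec E p, x⟫_ℂ‖ₑ ^ 2 ≤ 4 * ‖x‖ₑ ^ 2 := by
  have h (a b : ℝ≥0∞) : (a + b) ^ 2 ≤ 2 * (a ^ 2 + b ^ 2) := by
    have := ENNReal.rpow_add_le_mul_rpow_add_rpow a b (p := 2) one_le_two
    norm_num at this
    exact_mod_cast this
  calc ∑ p, ‖⟪altVec E p, x⟫_ℂ‖ₑ ^ 2
      ≤ ∑ p : ι × ι, 2 * (‖⟪E p, x⟫_ℂ‖ₑ ^ 2 + ‖⟪E p.swap, x⟫_ℂ‖ₑ ^ 2) := by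
        refine Finset.sum_le_sum fun p _ => le_trans ?_ (h _ _)
        rw [altVec, inner_sub_left]
        gcongr
        exact enorm_sub_le
    _ = 4 * ∑ p, ‖⟪E p, x⟫_ℂ‖ₑ ^ 2 := by
        rw [← Finset.mul_sum, Finset.sum_add_distrib, sum_swap fun p => ‖⟪E p, x⟫_ℂ‖ₑ ^ 2]
        ring
    _ ≤ 4 * ‖x‖ₑ ^ 2 := by gcongr; exact hE.sum_enorm_inner_sq_le x

theorem sum_rankOne_altVec_lt [LinearOrder ι] (E : ι × ι → K) :
    ∑ p, rankOne ℂ (altVec E p) (altVec E p) =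
      (2 : ℂ) • ∑ p : ι × ι with p.1 < p.2, rankOne ℂ (altVec E p) (altVec E p) := by
  let g : ι × ι → (K →L[ℂ] K) := fun p => rankOne ℂ (altVec E p) (altVec E p)
  have hs : ∀ p, g p.swap = g p := fun p => by simp [g, altVec_swap]
  have hd : ∀ p : ι × ι, p.1 = p.2 → g p = 0 := fun p hp => by
    have : p.swap = p := Prod.ext hp.symm hp
    simp [g, altVec, this]
  have hsplit : ∀ p : ι × ι, g p = (if p.1 < p.2 then g p else 0) +
      (if p.swap.1 < p.swap.2 then g p.swap else 0) := fun p => by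
    rw [hs, Prod.fst_swap, Prod.snd_swap]
    rcases lt_trichotomy p.1 p.2 with h | h | h
    · simp [h, h.not_gt]
    · simp [hd p h]
    · simp [h, h.not_gt]
  rw [Finset.sum_congr rfl fun p _ => hsplit p, Finset.sum_add_distrib,
    sum_swap fun p : ι × ι => if p.1 < p.2 then g p else 0, ← Finset.sum_filter, two_smul]

end Antisym

/-! ### Hilbert space tensor products -/

section Tensor

variable {HA : Type*} [NormedAddCommGroup HA] [InnerProductSpace ℂ HA]
variable {HB : Type*} [NormedAddCommGroup HB] [InnerProductSpace ℂ HB]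

theorem tensorVec_eq (a : HA) (b : HB) :
    tensorVec a b = UniformSpace.Completion.toComplL (𝕜 := ℂ) (a ⊗ₜ[ℂ] b) := rfl

theorem inner_tensorVec (a a' : HA) (b b' : HB) :
    ⟪tensorVec a b, tensorVec a' b'⟫_ℂ = ⟪a, a'⟫_ℂ * ⟪b, b'⟫_ℂ := by
  simp [tensorVec, UniformSpace.Completion.inner_coe]

theorem tensorOp_tensorVec (A : HA →L[ℂ] HA) (B : HB →L[ℂ] HB) (a : HA) (b : HB) :
    tensorOp A B (tensorVec a b) = tensorVec (A a) (B b) := by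
  simp [tensorOp, tensorVec]

theorem hilbertTensor_ext {S T : HilbertTensor HA HB →L[ℂ] HilbertTensor HA HB}
    (h : ∀ a b, S (tensorVec a b) = T (tensorVec a b)) : S = T := by
  ext x
  induction x using UniformSpace.Completion.induction_on with
  | hp => exact isClosed_eq S.continuous T.continuous
  | ih x =>
    induction x using TensorProduct.induction_on with
    | zero => rw [UniformSpace.Completion.coe_zero, map_zero, map_zero]
    | tmul a b => exact h a b
    | add x y hx hy => rw [UniformSpace.Completion.coe_add, map_add, map_add, hx, hy]

/-- The vectors `eᵤ ⊗ fᵥ`. -/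
noncomputable def tensorFamily {ι κ : Type*} (e : ι → HA) (f : κ → HB) (p : ι × κ) :
    HilbertTensor HA HB :=
  tensorVec (e p.1) (f p.2)

theorem orthonormal_tensorFamily {ι κ : Type*} {e : ι → HA} {f : κ → HB} (he : Orthonormal ℂ e)
    (hf : Orthonormal ℂ f) : Orthonormal ℂ (tensorFamily e f) := by
  classical
  rw [orthonormal_iff_ite] at *
  rintro ⟨u, v⟩ ⟨u', v'⟩
  simp only [tensorFamily, inner_tensorVec, he, hf, Prod.mk.injEq]
  split_ifs <;> simp_all

theorem tensorOp_smul_sum_rankOne {ι κ : Type*} [Fintype ι] [Fintype κ] (c d : ℂ) (e : ι → HA)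
    (f : κ → HB) :
    tensorOp (c • ∑ u, rankOne ℂ (e u) (e u)) (d • ∑ v, rankOne ℂ (f v) (f v)) =
      (c * d) • ∑ p, rankOne ℂ (tensorFamily e f p) (tensorFamily e f p) := by
  refine hilbertTensor_ext fun a b => ?_
  rw [tensorOp_tensorVec]
  simp only [smul_apply, sum_apply, rankOne_apply, tensorFamily, inner_tensorVec,
    Fintype.sum_prod_type]
  simp only [tensorVec_eq, TensorProduct.smul_tmul_smul, TensorProduct.sum_tmul,
    TensorProduct.tmul_sum, map_smul, map_sum]
  rw [Finset.sum_comm]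

/-- For a product of positive operators the swap part `∑ᵤᵥ ⟨eᵤ ⊗ fᵥ, (A ⊗ B) (eᵥ ⊗ fᵤ)⟩` is
nonnegative. -/
theorem sum_inner_tensorOp_swap_nonneg {ι : Type*} [Fintype ι] {A : HA →L[ℂ] HA} {B : HB →L[ℂ] HB}
    (hA : A.IsPositive) (hB : B.IsPositive) (e : ι → HA) (f : ι → HB) :
    0 ≤ (∑ p : ι × ι, ⟪tensorFamily e f p, tensorOp A B (tensorFamily e f p.swap)⟫_ℂ).re := by
  simp only [tensorFamily, tensorOp_tensorVec, inner_tensorVec, Fintype.sum_prod_type,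
    Prod.fst_swap, Prod.snd_swap, Complex.re_sum]
  exact sum_inner_mul_inner_nonneg hA hB e f

theorem antisymOp_eq {N : ℕ} {e : Fin N → HA} {f : Fin N → HB} (he : Orthonormal ℂ e)
    (hf : Orthonormal ℂ f) :
    antisymOp e f = (((2 * N * (N - 1))⁻¹ : ℝ) : ℂ) •
      ∑ p, rankOne ℂ (altVec (tensorFamily e f) p) (altVec (tensorFamily e f) p) := by
  have hE := orthonormal_tensorFamily he hf
  have hn : ∀ p : Fin N × Fin N, p.1 < p.2 → ((‖altVec (tensorFamily e f) p‖ : ℂ) ^ 2) = 2 := by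
    intro p hp
    have hne : p ≠ p.swap := fun h => hp.ne (Prod.ext_iff.1 h).1
    have := inner_self_eq_norm_sq_to_K (𝕜 := ℂ) (altVec (tensorFamily e f) p)
    refine this.symm.trans ?_
    simp only [altVec, inner_sub_left, inner_sub_right, orthonormal_iff_ite.1 hE, hne, hne.symm]
    norm_num
  rw [sum_rankOne_altVec_lt, antisymOp, smul_smul, Finset.smul_sum, Finset.smul_sum]
  refine Finset.sum_congr rfl fun p hp => ?_
  change _ • (ℂ ∙ altVec (tensorFamily e f) p).starProjection = _
  rw [starProjection_span_singleton_eq_smul_rankOne, hn p (Finset.mem_filter.1 hp).2, smul_smul]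
  congr 1
  push_cast
  simp only [div_eq_mul_inv, mul_inv, inv_inv]
  ring

end Tensor

/-! ### Uniform states and the antisymmetric state -/

section Uniform

variable {H : Type*} [NormedAddCommGroup H] [InnerProductSpace ℂ H]

theorem sum_rankOne_eq_starProjection {ι : Type*} [Fintype ι] {e : ι → H} (he : Orthonormal ℂ e)
    {U : Submodule ℂ H} [U.HasOrthogonalProjection] (hU : Submodule.span ℂ (Set.range e) = U) :
    ∑ i, rankOne ℂ (e i) (e i) = U.starProjection := by
  classical
  ext x
  refine (Submodule.eq_starProjection_of_mem_of_inner_eq_zero ?_ ?_).symm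
  · simp only [sum_apply, rankOne_apply]
    exact U.sum_mem fun i _ => U.smul_mem _ (hU ▸ Submodule.subset_span ⟨i, rfl⟩)
  · intro w hw
    rw [← hU] at hw
    induction hw using Submodule.span_induction with
    | mem w hw =>
      obtain ⟨i, rfl⟩ := hw
      simp [sum_apply, inner_sub_left, sum_inner, inner_smul_left, orthonormal_iff_ite.1 he]
    | zero => simp
    | add x y _ _ hx hy => rw [inner_add_right, hx, hy, add_zero]
    | smul c x _ hx => rw [inner_smul_right, hx, mul_zero]

theorem uniformOp_eq {ℓ : ℕ} {enc : (Fin ℓ → Bool) → H} (h : Orthonormal ℂ enc) :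
    uniformOp enc = ((((2 : ℝ) ^ ℓ)⁻¹ : ℝ) : ℂ) • ∑ x, rankOne ℂ (enc x) (enc x) := by
  rw [uniformOp]
  push_cast
  congr 1
  refine Finset.sum_congr rfl fun x _ => ?_
  rw [starProjection_span_singleton_eq_smul_rankOne, h.1 x]
  simp

variable [CompleteSpace H]

/-- The uniform mixture of a nonempty finite orthonormal family. -/
noncomputable def uniformState {ι : Type*} [Fintype ι] [Nonempty ι] (w : ι → H)
    (hw : Orthonormal ℂ w) : DensityOperator H where
  op := (((Fintype.card ι : ℝ)⁻¹ : ℝ) : ℂ) • ∑ i, rankOne ℂ (w i) (w i)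
  pos := isPositive_smul_sum_rankOne (by positivity) w
  trace_eq_one := by
    rw [opTrace_smul_sum_rankOne]
    simp [inner_self_eq_norm_sq_to_K, hw.1]

theorem uniformOp_eq_uniformState {ℓ : ℕ} {enc : (Fin ℓ → Bool) → H} (h : Orthonormal ℂ enc) :
    uniformOp enc = (uniformState enc h).op := by
  rw [uniformOp_eq h, uniformState]
  simp

end Uniform

section Antisym

variable {HA : Type*} [NormedAddCommGroup HA] [InnerProductSpace ℂ HA]
variable {HB : Type*} [NormedAddCommGroup HB] [InnerProductSpace ℂ HB]

theorem sum_inner_antisymOp {N : ℕ} (hN : 2 ≤ N) {e : Fin N → HA} {f : Fin N → HB}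
    (he : Orthonormal ℂ e) (hf : Orthonormal ℂ f) :
    ∑ p, ⟪altVec (tensorFamily e f) p, antisymOp e f (altVec (tensorFamily e f) p)⟫_ℂ = 4 := by
  have hE := orthonormal_tensorFamily he hf
  have h1 : (N : ℂ) ≠ 0 := by norm_cast; omega
  have h2 : (N : ℂ) - 1 ≠ 0 := sub_ne_zero.2 (by norm_cast; omega)
  simp only [antisymOp_eq he hf, smul_apply, sum_rankOne_altVec_apply hE, inner_smul_right]
  rw [← Finset.mul_sum, ← Finset.mul_sum, sum_inner_altVec_self hE]
  push_cast
  rw [Fintype.card_fin]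
  field_simp

/-- Under a local measurement the antisymmetric subspace is nowhere more likely than the symmetric
one: this holds on measurable rectangles, hence everywhere. -/
theorem sumMeasure_altVec_le_sumMeasure_symVec {ι : Type*} [Fintype ι] {ΩA ΩB : Type}
    [MeasurableSpace ΩA] [MeasurableSpace ΩB] {MA : POVM HA ΩA} {MB : POVM HB ΩB}
    {M : POVM (HilbertTensor HA HB) (ΩA × ΩB)}
    (hM : ∀ S T, MeasurableSet S → MeasurableSet T →
      M.effect (S ×ˢ T) = tensorOp (MA.effect S) (MB.effect T)) (e : ι → HA) (f : ι → HB) :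
    M.sumMeasure (altVec (tensorFamily e f)) ≤ M.sumMeasure (symVec (tensorFamily e f)) := by
  refine measure_le_of_rectangles fun S T hS hT => ?_
  rw [M.sumMeasure_apply _ (hS.prod hT), M.sumMeasure_apply _ (hS.prod hT)]
  refine ENNReal.ofReal_le_ofReal ?_
  have h := sum_inner_tensorOp_swap_nonneg (MA.pos S hS) (MB.pos T hT) e f
  rw [← Complex.re_sum, ← Complex.re_sum, sum_inner_altVec, sum_inner_symVec, hM S T hS hT,
    show (2 : ℂ) = ((2 : ℝ) : ℂ) by norm_num, Complex.re_ofReal_mul, Complex.re_ofReal_mul,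
    Complex.sub_re, Complex.add_re]
  linarith


/-- The normalised projection onto the antisymmetric subspace, as a state. -/
noncomputable def antisymState {N : ℕ} (hN : 2 ≤ N) (e : Fin N → HA) (f : Fin N → HB)
    (he : Orthonormal ℂ e) (hf : Orthonormal ℂ f) : DensityOperator (HilbertTensor HA HB) where
  op := antisymOp e f
  pos := by
    have : (2 : ℝ) ≤ N := by exact_mod_cast hN
    rw [antisymOp_eq he hf]
    exact isPositive_smul_sum_rankOne (inv_nonneg.2 (by nlinarith)) _
  trace_eq_one := by
    have h1 : (N : ℂ) ≠ 0 := by norm_cast; omega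
    have h2 : (N : ℂ) - 1 ≠ 0 := sub_ne_zero.2 (by norm_cast; omega)
    rw [antisymOp_eq he hf, opTrace_smul_sum_rankOne,
      sum_inner_altVec_self (orthonormal_tensorFamily he hf)]
    push_cast
    rw [Fintype.card_fin]
    field_simp

/-- A local measurement distinguishes the antisymmetric state from the maximally mixed product state
with advantage at most `1 / N`: the maximally mixed state exceeds the antisymmetric one by at most
the measure `F ↦ N⁻² tr (M(F) W)`, where `W` is the swap, and `tr W = N`. -/
theorem measDist_antisymState_le {N : ℕ} (hN : 2 ≤ N) {e : Fin N → HA} {f : Fin N → HB}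
    (he : Orthonormal ℂ e) (hf : Orthonormal ℂ f) (τ : DensityOperator (HilbertTensor HA HB))
    (hτ : τ.op = ((((N : ℝ) ^ 2)⁻¹ : ℝ) : ℂ) •
      ∑ p, rankOne ℂ (tensorFamily e f p) (tensorFamily e f p)) :
    measDist (localMeasurements HA HB) (antisymState hN e f he hf) τ ≤ (N : ℝ≥0∞)⁻¹ := by
  have hE := orthonormal_tensorFamily he hf
  have hN2 : (2 : ℝ) ≤ N := by exact_mod_cast hN
  suffices h : ∀ M ∈ localMeasurements HA HB,
      (l1Norm fun F => outcomeProb M (antisymState hN e f he hf) F - outcomeProb M τ F) ≤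
        2 * (N : ℝ≥0∞)⁻¹ by
    refine (mul_le_mul_right (iSup₂_le h) _).trans ?_
    rw [← mul_assoc, ENNReal.inv_mul_cancel (by norm_num) (by norm_num), one_mul]
  rintro _ ⟨ΩA, ΩB, _, _, MA, MB, M, hM, rfl⟩
  set E := tensorFamily e f
  -- `α` and `β` are the distributions of four times the antisymmetric and symmetric projections.
  set α := (M.sumMeasure (altVec E)).toSignedMeasure with hα
  set β := (M.sumMeasure (symVec E)).toSignedMeasure with hβ
  have hαβ : ∀ S, MeasurableSet S → α S ≤ β S := fun S hS =>
    ((Measure.toSignedMeasure_le_toSignedMeasure_iff _ _).2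
      (sumMeasure_altVec_le_sumMeasure_symVec hM e f)) S hS
  have hα0 : ∀ S, MeasurableSet S → 0 ≤ α S := fun S hS => by
    rw [hα, Measure.toSignedMeasure_apply_measurable hS]
    positivity
  have hρ : ∀ S, MeasurableSet S → (opTrace (M.effect S ∘L (antisymState hN e f he hf).op)).re =
      (2 * N * (N - 1) : ℝ)⁻¹ * α S := fun S hS => by
    change (opTrace (M.effect S ∘L antisymOp e f)).re = _
    rw [antisymOp_eq he hf, opTrace_comp_smul_sum_rankOne, Complex.re_ofReal_mul, Complex.re_sum,
      hα, M.sumMeasure_toSignedMeasure_apply _ hS]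
  have hτ' : ∀ S, MeasurableSet S → (opTrace (M.effect S ∘L τ.op)).re =
      (4 * (N : ℝ) ^ 2)⁻¹ * (α S + β S) := fun S hS => by
    rw [hτ, opTrace_comp_smul_sum_rankOne, Complex.re_ofReal_mul,
      hα, M.sumMeasure_toSignedMeasure_apply _ hS, hβ, M.sumMeasure_toSignedMeasure_apply _ hS,
      ← Complex.re_sum, ← Complex.re_sum, sum_inner_altVec, sum_inner_symVec, ← Complex.add_re,
      ← mul_add, sub_add_add_cancel, ← two_mul, ← mul_assoc, show (2 * 2 : ℂ) = ((4 : ℝ) : ℂ) by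
      norm_num, Complex.re_ofReal_mul, mul_inv]
    ring
  have hαu : α Set.univ = 2 * ((N : ℝ) ^ 2 - N) := by
    rw [hα, M.sumMeasure_toSignedMeasure_apply _ .univ, M.effect_univ, ← Complex.re_sum]
    have := congrArg Complex.re (sum_inner_altVec_self hE)
    rw [Fintype.card_fin] at this
    exact_mod_cast this
  have hβu : β Set.univ = 2 * ((N : ℝ) ^ 2 + N) := by
    rw [hβ, M.sumMeasure_toSignedMeasure_apply _ .univ, M.effect_univ, ← Complex.re_sum]
    have := congrArg Complex.re (sum_inner_symVec_self hE)
    rw [Fintype.card_fin] at this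
    exact_mod_cast this
  have hN1 : (N : ℝ) - 1 ≠ 0 := by linarith
  have hN0 : (N : ℝ) ≠ 0 := by linarith
  -- `D` is the difference of the outcome distributions, and `β - α` is four times the swap part.
  refine (l1Norm_le_of_signedMeasure
    (D := (2 * N * (N - 1) : ℝ)⁻¹ • α - (4 * (N : ℝ) ^ 2)⁻¹ • (α + β))
    (h := (4 * (N : ℝ) ^ 2)⁻¹ • (β - α)) ?_ ?_ ?_ ?_).trans ?_
  · intro S hS
    simp only [outcomeProb, hρ S hS, hτ' S hS, sub_apply, smul_apply,
      add_apply, smul_eq_mul]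
  · simp only [sub_apply, smul_apply,
      add_apply, smul_eq_mul, hαu, hβu]
    field_simp
    ring
  · intro S hS
    simp only [sub_apply, smul_apply, smul_eq_mul]
    have := hαβ S hS
    exact mul_nonneg (by positivity) (by linarith)
  · intro S hS
    simp only [sub_apply, smul_apply, add_apply,
      smul_eq_mul]
    have hc : 2 * (4 * (N : ℝ) ^ 2)⁻¹ ≤ (2 * N * (N - 1) : ℝ)⁻¹ := by
      rw [show 2 * (4 * (N : ℝ) ^ 2)⁻¹ = (2 * (N : ℝ) ^ 2)⁻¹ by field_simp; norm_num]
      exact inv_anti₀ (by nlinarith) (by nlinarith)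
    have := mul_le_mul_of_nonneg_right hc (hα0 S hS)
    linarith
  · simp only [sub_apply, smul_apply, smul_eq_mul, hαu, hβu]
    rw [show 2 * ((4 * (N : ℝ) ^ 2)⁻¹ * (2 * ((N : ℝ) ^ 2 + N) - 2 * ((N : ℝ) ^ 2 - N))) =
      2 * (N : ℝ)⁻¹ by field_simp; ring, ENNReal.ofReal_mul (by norm_num),
      ENNReal.ofReal_inv_of_pos (by linarith), ENNReal.ofReal_ofNat, ENNReal.ofReal_natCast]

variable [CompleteSpace HA] [CompleteSpace HB]

/-- A product state has overlap at most `1/2` with the antisymmetric subspace. (The vectors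
`altVec` carry four times the projection onto this subspace.) -/
theorem sum_re_inner_tensorOp_altVec_le {ι : Type*} [Fintype ι] {e : ι → HA} {f : ι → HB}
    (he : Orthonormal ℂ e) (hf : Orthonormal ℂ f) (ρ : DensityOperator HA)
    (σ : DensityOperator HB) :
    ∑ p, (⟪altVec (tensorFamily e f) p,
      tensorOp ρ.op σ.op (altVec (tensorFamily e f) p)⟫_ℂ).re ≤ 2 := by
  rw [← Complex.re_sum, sum_inner_altVec]
  have h0 := sum_inner_tensorOp_swap_nonneg ρ.pos σ.pos e f
  have h1 := sum_re_inner_le_one he ρ.pos ρ.trace_eq_one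
  have h2 := sum_re_inner_le_one hf σ.pos σ.trace_eq_one
  have n1 : 0 ≤ ∑ u, (⟪e u, ρ.op (e u)⟫_ℂ).re :=
    Finset.sum_nonneg fun u _ => ρ.pos.re_inner_nonneg_right (e u)
  have n2 : 0 ≤ ∑ v, (⟪f v, σ.op (f v)⟫_ℂ).re :=
    Finset.sum_nonneg fun v _ => σ.pos.re_inner_nonneg_right (f v)
  have h3 : (∑ p, ⟪tensorFamily e f p, tensorOp ρ.op σ.op (tensorFamily e f p)⟫_ℂ).re =
      (∑ u, (⟪e u, ρ.op (e u)⟫_ℂ).re) * ∑ v, (⟪f v, σ.op (f v)⟫_ℂ).re := by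
    simp only [tensorFamily, tensorOp_tensorVec, inner_tensorVec, Fintype.sum_prod_type,
      Complex.re_sum, Finset.sum_mul_sum]
    refine Finset.sum_congr rfl fun u _ => Finset.sum_congr rfl fun v _ => ?_
    have : (⟪e u, ρ.op (e u)⟫_ℂ).im = 0 :=
      (Complex.le_def.1 (ρ.pos.inner_nonneg_right (e u))).2.symm
    rw [Complex.mul_re, this, zero_mul, sub_zero]
  have h4 : (∑ u, (⟪e u, ρ.op (e u)⟫_ℂ).re) * ∑ v, (⟪f v, σ.op (f v)⟫_ℂ).re ≤ 1 := by
    nlinarith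
  rw [show (2 : ℂ) = ((2 : ℝ) : ℂ) by norm_num, Complex.re_ofReal_mul, Complex.sub_re, h3]
  linarith

/-- The antisymmetric state has overlap `1` with the antisymmetric subspace, so the overlaps with
any product state differ by at least `1/2`, which is at most the trace norm of the difference. -/
theorem quarter_le_traceDist_antisymState {N : ℕ} (hN : 2 ≤ N) {e : Fin N → HA} {f : Fin N → HB}
    (he : Orthonormal ℂ e) (hf : Orthonormal ℂ f) (ρ : DensityOperator HA)
    (σ : DensityOperator HB) (τ : DensityOperator (HilbertTensor HA HB))
    (hτ : τ.op = tensorOp ρ.op σ.op) :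
    1 / 4 ≤ traceDist (antisymState hN e f he hf) τ := by
  have h := ofReal_sum_re_inner_le_traceNorm
    (sum_enorm_inner_altVec_sq_le (orthonormal_tensorFamily he hf))
    ((antisymState hN e f he hf).pos.isSelfAdjoint.sub τ.pos.isSelfAdjoint)
  have h2 : (2 : ℝ≥0∞) ≤ 4 * traceNorm ((antisymState hN e f he hf).op - τ.op) := by
    refine le_trans ?_ h
    rw [← ENNReal.ofReal_ofNat 2]
    refine ENNReal.ofReal_le_ofReal ?_
    have h4 := congrArg Complex.re (sum_inner_antisymOp hN he hf)
    rw [Complex.re_sum] at h4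
    have hle := sum_re_inner_tensorOp_altVec_le he hf ρ σ
    simp only [sub_apply, inner_sub_right, Complex.sub_re, Finset.sum_sub_distrib, hτ]
    change _ ≤ ∑ p, (⟪altVec (tensorFamily e f) p, antisymOp e f _⟫_ℂ).re - _
    rw [h4]
    norm_num
    linarith
  calc (1 / 4 : ℝ≥0∞) = 8⁻¹ * 2 := by
        rw [show (8 : ℝ≥0∞) = 4 * 2 by norm_num, ENNReal.mul_inv (by norm_num) (by norm_num),
          mul_assoc, ENNReal.inv_mul_cancel (by norm_num) (by norm_num)]
        simp
    _ ≤ 8⁻¹ * (4 * traceNorm ((antisymState hN e f he hf).op - τ.op)) := by gcongr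
    _ = traceDist (antisymState hN e f he hf) τ := by
        rw [traceDist, ← mul_assoc]
        congr 1
        rw [show (8 : ℝ≥0∞) = 2 * 4 by norm_num, ENNReal.mul_inv (by norm_num) (by norm_num),
          mul_assoc, ENNReal.inv_mul_cancel (by norm_num) (by norm_num), mul_one]

end Antisym

/-! ### Random strings -/

section Random

variable {HR : Type*} [NormedAddCommGroup HR] [InnerProductSpace ℂ HR] [CompleteSpace HR]
variable {HE : Type*} [NormedAddCommGroup HE] [InnerProductSpace ℂ HE] [CompleteSpace HE]

/-- The nearby random state is `Π̄⁽ⁿ⁾ ⊗ σ` with `σ` uniform on the vectors `f`. -/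
theorem exists_antisymOp_far_and_near {L : Set ℕ} {enc : (ℓ : ℕ) → (Fin ℓ → Bool) → HR}
    (henc : ∀ ℓ ∈ L, Orthonormal ℂ (enc ℓ)) {n : ℕ} (hn : n ∈ L) (hn1 : 1 ≤ n)
    {e : Fin (2 ^ n) → HR} {f : Fin (2 ^ n) → HE} (he : Orthonormal ℂ e) (hf : Orthonormal ℂ f)
    (hspan : Submodule.span ℂ (Set.range e) = Submodule.span ℂ (Set.range (enc n))) :
    ∃ ρ : DensityOperator (HilbertTensor HR HE), ρ.op = antisymOp e f ∧
      1 / 4 ≤ distToSet traceDist ρ (randomStates HE L enc) ∧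
      distToSet (measDist (localMeasurements HR HE)) ρ (randomStates HE L enc) ≤
        ((2 : ℝ≥0∞) ^ n)⁻¹ := by
  have hN : 2 ≤ 2 ^ n := by simpa using Nat.pow_le_pow_right two_pos hn1
  refine ⟨antisymState hN e f he hf, rfl, le_iInf₂ ?_, ?_⟩
  · rintro τ ⟨ℓ, hℓ, σ, hτ⟩
    rw [uniformOp_eq_uniformState (henc ℓ hℓ)] at hτ
    exact quarter_le_traceDist_antisymState hN he hf _ σ τ hτ
  · have : FiniteDimensional ℂ (Submodule.span ℂ (Set.range (enc n))) :=
      FiniteDimensional.span_of_finite ℂ (Set.finite_range _)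
    have hU : tensorOp (uniformOp (enc n)) (uniformState f hf).op =
        (((((2 ^ n : ℕ) : ℝ) ^ 2)⁻¹ : ℝ) : ℂ) •
          ∑ p, rankOne ℂ (tensorFamily e f p) (tensorFamily e f p) := by
      rw [uniformOp_eq (henc n hn), uniformState, sum_rankOne_eq_starProjection (henc n hn) rfl,
        ← sum_rankOne_eq_starProjection he hspan, tensorOp_smul_sum_rankOne]
      congr 1
      simp [sq]
    let τ : DensityOperator (HilbertTensor HR HE) :=
      { op := tensorOp (uniformOp (enc n)) (uniformState f hf).op
        pos := hU ▸ isPositive_smul_sum_rankOne (by positivity) _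
        trace_eq_one := by
          rw [hU, opTrace_smul_sum_rankOne]
          simp [inner_self_eq_norm_sq_to_K, (orthonormal_tensorFamily he hf).1, sq]
          field_simp }
    refine (iInf₂_le τ ⟨n, hn, _, rfl⟩).trans ?_
    simpa using measDist_antisymState_le hN he hf τ hU

theorem exists_orthonormal_nat {H : Type*} [NormedAddCommGroup H] [InnerProductSpace ℂ H]
    (h : ¬ FiniteDimensional ℂ H) : ∃ b : ℕ → H, Orthonormal ℂ b := by
  have v := Module.Free.chooseBasis ℂ H
  have hinf : Infinite (Module.Free.ChooseBasisIndex ℂ H) := by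
    by_contra hfin
    rw [not_infinite_iff_finite] at hfin
    exact h v.finiteDimensional_of_finite
  exact ⟨_, gramSchmidtNormed_orthonormal
    (v.linearIndependent.comp _ (Infinite.natEmbedding _).injective)⟩

/-- The antisymmetric states of growing dimension approach the random states for `measDist`, but not
for `traceDist`. -/
theorem not_isRobust_localMeasurements (hR : ¬ FiniteDimensional ℂ HR)
    (hE : ¬ FiniteDimensional ℂ HE) : ¬ IsRobust (localMeasurements HR HE) := by
  obtain ⟨a, ha⟩ := exists_orthonormal_nat hR
  obtain ⟨b, hb⟩ := exists_orthonormal_nat hE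
  -- Encode the strings of each length by an initial segment of the orthonormal sequence `a`.
  let idx : (ℓ : ℕ) → (Fin ℓ → Bool) ≃ Fin (2 ^ ℓ) := fun ℓ => Fintype.equivFinOfCardEq (by simp)
  let enc : (ℓ : ℕ) → (Fin ℓ → Bool) → HR := fun ℓ x => a (idx ℓ x)
  have key : ∀ n : ℕ, ∃ ρ : DensityOperator (HilbertTensor HR HE),
      1 / 4 ≤ distToSet traceDist ρ (randomStates HE Set.univ enc) ∧
      distToSet (measDist (localMeasurements HR HE)) ρ (randomStates HE Set.univ enc) ≤
        ((2 : ℝ≥0∞) ^ (n + 1))⁻¹ := fun n => by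
    obtain ⟨ρ, -, h⟩ := exists_antisymOp_far_and_near (L := Set.univ) (enc := enc)
      (e := fun i : Fin (2 ^ (n + 1)) => a i) (f := fun i : Fin (2 ^ (n + 1)) => b i)
      (fun ℓ _ => ha.comp _ (Fin.val_injective.comp (idx ℓ).injective)) (Set.mem_univ (n + 1))
      (Nat.le_add_left 1 n) (ha.comp _ Fin.val_injective) (hb.comp _ Fin.val_injective)
      (by
        congr 1
        exact ((idx (n + 1)).surjective.range_comp fun i : Fin (2 ^ (n + 1)) => a i).symm)
    exact ⟨ρ, h⟩
  choose ρ hfar hnear using key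
  intro hrob
  have h0 := hrob _ ρ (tendsto_of_tendsto_of_tendsto_of_le_of_le tendsto_const_nhds
    (by
      have := (ENNReal.tendsto_pow_atTop_nhds_zero_of_lt_one (r := 2⁻¹) (by norm_num)).comp
        (tendsto_add_atTop_nat 1)
      simpa [Function.comp_def, ENNReal.inv_pow] using this) (fun _ => zero_le) hnear)
  have := ge_of_tendsto' h0 hfar
  norm_num at this

end Random

end ProbRep

theorem mainTheorem3 :
    -- for infinite-dimensional subsystems, the representation by local measurements is not robust
    (∀ (HA : Type u) [NormedAddCommGroup HA] [InnerProductSpace ℂ HA] [CompleteSpace HA]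
      (HB : Type v) [NormedAddCommGroup HB] [InnerProductSpace ℂ HB] [CompleteSpace HB]
      [TopologicalSpace.SeparableSpace HA] [TopologicalSpace.SeparableSpace HB],
      ¬ FiniteDimensional ℂ HA → ¬ FiniteDimensional ℂ HB →
      ¬ ProbRep.IsRobust (ProbRep.localMeasurements HA HB)) ∧
    -- antisymmetric states versus perfectly random states
    (∀ (HR : Type u) [NormedAddCommGroup HR] [InnerProductSpace ℂ HR] [CompleteSpace HR]
      (HE : Type v) [NormedAddCommGroup HE] [InnerProductSpace ℂ HE] [CompleteSpace HE]
      (L : Set ℕ) (enc : (ℓ : ℕ) → (Fin ℓ → Bool) → HR),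
      (∀ ℓ ∈ L, Orthonormal ℂ (enc ℓ)) →
      ∀ n ∈ L, 1 ≤ n → ∀ (e : Fin (2 ^ n) → HR) (f : Fin (2 ^ n) → HE),
      Orthonormal ℂ e → Orthonormal ℂ f →
      Submodule.span ℂ (Set.range e) = Submodule.span ℂ (Set.range (enc n)) →
      ∃ ρ : ProbRep.DensityOperator (ProbRep.HilbertTensor HR HE),
        ρ.op = ProbRep.antisymOp e f ∧
        1 / 4 ≤ ProbRep.distToSet ProbRep.traceDist ρ (ProbRep.randomStates HE L enc) ∧
        ProbRep.distToSet (ProbRep.measDist (ProbRep.localMeasurements HR HE)) ρ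
          (ProbRep.randomStates HE L enc) ≤ ((2 : ℝ≥0∞) ^ n)⁻¹) :=
  ⟨fun _ _ _ _ _ _ _ _ _ _ hA hB => ProbRep.not_isRobust_localMeasurements hA hB,
    fun _ _ _ _ _ _ _ _ _ _ henc _ hn hn1 _ _ he hf hspan =>
      ProbRep.exists_antisymOp_far_and_near henc hn hn1 he hf hspan⟩
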